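/- Theorem (the normal crossing divisors are the only Abelian linear free divisors). Let $V=\mathbb{C}^n$ with coordinate ring $\mathbb{C}[V]=\mathbb{C}[x_1,\dots,x_n]$, and let $D\subset V$ be the divisor defined by a reduced (that is, squarefree, in particular nonzero) polynomial $f\in\mathbb{C}[V]$. Call $D$ a \emph{linear free divisor} if the $\mathbb{C}[V]$-module $$\operatorname{Der}(-\log D)=\{\delta\in\operatorname{Der}_{\mathbb{C}}(\mathbb{C}[V]) : \delta(f)\in(f)\}$$ of logarithmic vector fields is free with a basis $\delta_1,\dots,\delta_n$ of linear vector fields, i.e. such that every coefficient $\delta_i(x_j)$ is zero or a homogeneous polynomial of degree $1$. Let $G$ be the largest (Zariski) connected subgroup of $\operatorname{GL}(V)$ preserving the zero set of $f$, and let $H$ be the largest connected subgroup of the isotropy group $\operatorname{GL}(V)_f=\{g\in \operatorname{GL}(V): f(gx)=f(x)\ \text{for all } x\in V\}$. Then the following are equivalent: 1. $D$ is a linear free divisor and $G$ is Abelian; 2. $D$ is a linear free divisor and $H$ is Abelian; 3. $D$ is a normal crossing divisor in the following sense: there are linear coordinates $y_1,\dots,y_n$ on $V$ and a constant $c\in\mathbb{C}\setminus\{0\}$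 such that $f=c\,y_1\cdots y_n$. -/

import Mathlib

namespace LinearFreeDivisor

open MvPolynomial

/-- The coordinate ring `ℂ[x₁, …, xₙ]` of affine `n`-space `V = ℂⁿ`. -/
abbrev Coord (n : ℕ) : Type := MvPolynomial (Fin n) ℂ

/-- The hypersurface `D ⊆ V = ℂⁿ` defined by `f`. -/
def hypersurface {n : ℕ} (f : Coord n) : Set (Fin n → ℂ) := {x | eval x f = 0}

/-- Algebraic vector fields on `V`: the `ℂ`-linear derivations of the coordinate ring. -/
abbrev VectorField (n : ℕ) : Type := Derivation ℂ (Coord n) (Coord n)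

/-- A vector field is linear if all its coefficients `δ(xⱼ)` are linear forms (or zero). -/
def IsLinearField {n : ℕ} (δ : VectorField n) : Prop :=
  ∀ j : Fin n, (δ (X j)).IsHomogeneous 1

/-- `Der(-log D)`: the logarithmic vector fields along the divisor with reduced equation `f`, that
is, the vector fields `δ` that preserve the ideal `(f)`. As `V` is affine, the (quasi-coherent)
sheaf of logarithmic vector fields is given by this module of global sections. -/
def logFields {n : ℕ} (f : Coord n) : Submodule (Coord n) (VectorField n) where
  carrier := {δ | f ∣ δ f}
  add_mem' {a b} ha hb := by
    simpa only [Set.mem_ofPred_eq, Derivation.add_apply] using dvd_add ha hb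
  zero_mem' := by simp
  smul_mem' c a ha := by
    simpa only [Set.mem_ofPred_eq, Derivation.smul_apply, smul_eq_mul] using
      Dvd.dvd.mul_left ha c

/-- The divisor with reduced equation `f` is linear free: `Der(-log D)` has a basis
`δ₁, …, δₙ` consisting of linear vector fields. -/
def IsLinearFree {n : ℕ} (f : Coord n) : Prop :=
  ∃ δ : Module.Basis (Fin n) (Coord n) (logFields f), ∀ i, IsLinearField (δ i : VectorField n)

/-- The Zariski topology on `GLₙ(ℂ)`: the sets `{g | p(g) ≠ 0}`, for `p` a polynomial in the
matrix entries, form a basis of open sets. -/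
def zariski (n : ℕ) : TopologicalSpace (GL (Fin n) ℂ) :=
  TopologicalSpace.generateFrom
    {U | ∃ p : MvPolynomial (Fin n × Fin n) ℂ,
      U = {g : GL (Fin n) ℂ | eval (fun ij => g ij.1 ij.2) p ≠ 0}}

/-- The largest (Zariski) connected subgroup `K°` of a subgroup `K` of `GLₙ(ℂ)`. -/
def connectedPart {n : ℕ} (K : Subgroup (GL (Fin n) ℂ)) : Subgroup (GL (Fin n) ℂ) :=
  sSup {L | L ≤ K ∧ @IsConnected (GL (Fin n) ℂ) (zariski n) (L : Set (GL (Fin n) ℂ))}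

/-- The subgroup of all `g ∈ GL(V)` with `g(D) = D`. -/
def preserver {n : ℕ} (D : Set (Fin n → ℂ)) : Subgroup (GL (Fin n) ℂ) where
  carrier := {g | (fun x => g.val.mulVec x) '' D = D}
  one_mem' := by simp
  mul_mem' {a b} ha hb := by
    have h : (fun x => (a * b).val.mulVec x) =
        (fun x => a.val.mulVec x) ∘ (fun x => b.val.mulVec x) := by
      funext x
      simp [Matrix.mulVec_mulVec]
    simp only [Set.mem_ofPred_eq] at ha hb ⊢
    rw [h, Set.image_comp, hb, ha]
  inv_mem' {a} ha := by
    have h : (fun x => a⁻¹.val.mulVec x) ∘ (fun x => a.val.mulVec x) = id := by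
      funext x
      rw [Function.comp_apply, Matrix.mulVec_mulVec, a.inv_mul, Matrix.one_mulVec, id_eq]
    simp only [Set.mem_ofPred_eq] at ha ⊢
    conv_lhs => rw [← ha]
    rw [← Set.image_comp, h, Set.image_id]

/-- The isotropy group `GL(V)_f` of all `g ∈ GL(V)` with `f(g x) = f(x)` for all `x`. -/
def isotropy {n : ℕ} (f : Coord n) : Subgroup (GL (Fin n) ℂ) where
  carrier := {g | ∀ x : Fin n → ℂ, eval (g.val.mulVec x) f = eval x f}
  one_mem' := by simp
  mul_mem' {a b} ha hb x := by
    rw [← hb x, ← ha (b.val.mulVec x), Matrix.mulVec_mulVec, Units.val_mul]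
  inv_mem' {a} ha x := by
    rw [← ha (a⁻¹.val.mulVec x), Matrix.mulVec_mulVec, a.mul_inv, Matrix.one_mulVec]

/-- The group `G` of the divisor `D` with reduced equation `f`: the largest connected subgroup of
`GL(V)` preserving `D`. -/
def groupG {n : ℕ} (f : Coord n) : Subgroup (GL (Fin n) ℂ) :=
  connectedPart (preserver (hypersurface f))

/-- The group `H = (GL(V)_f)°`. -/
def groupH {n : ℕ} (f : Coord n) : Subgroup (GL (Fin n) ℂ) :=
  connectedPart (isotropy f)

/-- The divisor with reduced equation `f` is the normal crossing divisor: in suitable linear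
coordinates `yᵢ = ∑ⱼ gᵢⱼ xⱼ` on `V` it is defined by `y₁ ⋯ yₙ` (equations are unique up to units,
that is, nonzero constants). -/
def IsNormalCrossing {n : ℕ} (f : Coord n) : Prop :=
  ∃ g : GL (Fin n) ℂ, Associated f (∏ i, ∑ j, C (g i j) * X j)

end LinearFreeDivisor

/-! Let `δᵢ` be a basis of the logarithmic fields, where `δᵢ` has the value `aᵢ x` at the point `x`.
By Saito's argument `f` divides `det (aᵢ x)ᵢ`, which divides a power of `f`, so both have the same
zeros. The Euler field is logarithmic, and subtracting multiples of it from the `aᵢ` yields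
matrices that annihilate `f`; their exponentials lie in `H`. Hence if `H` is Abelian, the `aᵢ`
commute. Evaluation at a point `v` outside `D` then identifies the commutative algebra generated by
the `aᵢ` with `V`, and `det (aᵢ x)ᵢ = 0` means that `x` is not a unit of this algebra, that is, `x`
is killed by one of its characters. Characters are linearly independent, so `f` is, up to a
constant, a product of independent linear forms; there are `n` of them because no nonzero constant
field is logarithmic.

Conversely, the fields `yᵢ ∂/∂yᵢ` form a basis for `f = y₁ ⋯ yₙ`. A linear map that preserves the
union of the hyperplanes `yᵢ = 0` is monomial in the coordinates `y`, and among the monomial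
matrices the diagonal ones are cut out both by an open condition (no diagonal entry is zero) and by
a closed one, so a connected group of such maps is diagonal. -/

namespace LinearFreeDivisor

open MvPolynomial Matrix

section Derivation

variable {R A : Type*} [CommSemiring R] [CommRing A] [Algebra R A] {D : Derivation R A A}

theorem derivation_sum_apply {ι : Type*} (s : Finset ι) (δ : ι → Derivation R A A) (a : A) :
    (∑ i ∈ s, δ i) a = ∑ i ∈ s, δ i a := by
  rw [← Derivation.coeFnAddMonoidHom_apply, map_sum, Finset.sum_apply]
  simp only [Derivation.coeFnAddMonoidHom_apply]

theorem mul_dvd_derivation_mul {a b : A} (ha : a ∣ D a) (hb : b ∣ D b) : a * b ∣ D (a * b) := by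
  rw [D.leibniz, smul_eq_mul, smul_eq_mul]
  refine dvd_add (mul_dvd_mul_left a hb) ?_
  rw [mul_comm a b]
  exact mul_dvd_mul_left b ha

theorem prod_dvd_derivation_prod {ι : Type*} {s : Finset ι} {a : ι → A}
    (h : ∀ i ∈ s, a i ∣ D (a i)) : ∏ i ∈ s, a i ∣ D (∏ i ∈ s, a i) :=
  Finset.prod_induction a (fun b => b ∣ D b) (fun _ _ => mul_dvd_derivation_mul) (one_dvd _) h

variable [IsDomain A] [Algebra ℚ A]

theorem dvd_derivation_of_prime_of_dvd [WfDvdMonoid A] {p c : A} (hp : Prime p) (hc₀ : c ≠ 0)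
    (hc : c ∣ D c) (hpc : p ∣ c) : p ∣ D p := by
  obtain ⟨k, q, hpq, rfl⟩ := WfDvdMonoid.max_power_factor hc₀ hp.irreducible
  obtain ⟨k, rfl⟩ : ∃ m, k = m + 1 := Nat.exists_eq_succ_of_ne_zero fun hk => by
    simp only [hk, pow_zero, one_mul] at hpc
    exact hpq hpc
  have hleibniz : D (p ^ (k + 1) * q) =
      p ^ (k + 1) * D q + p ^ k * (((k + 1 : ℕ) : A) * (q * D p)) := by
    rw [D.leibniz, D.leibniz_pow, Nat.add_sub_cancel]
    simp only [smul_eq_mul, nsmul_eq_mul]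
    ring
  have hdvd : p ^ k * p ∣ p ^ k * (((k + 1 : ℕ) : A) * (q * D p)) := by
    rw [← pow_succ, ← dvd_add_right (dvd_mul_right (p ^ (k + 1)) (D q)), ← hleibniz]
    exact (dvd_mul_right _ _).trans hc
  have hunit : IsUnit ((k + 1 : ℕ) : A) := by
    rw [← map_natCast (algebraMap ℚ A)]
    exact (isUnit_iff_ne_zero.2 (Nat.cast_ne_zero.2 k.succ_ne_zero)).map _
  have hpD := (mul_dvd_mul_iff_left (pow_ne_zero k hp.ne_zero)).1 hdvd
  rw [hunit.dvd_mul_left] at hpD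
  exact (hp.dvd_or_dvd hpD).resolve_left hpq

theorem dvd_derivation_of_dvd [UniqueFactorizationMonoid A] {f c : A} (hc₀ : c ≠ 0)
    (hc : c ∣ D c) (hfc : f ∣ c) : f ∣ D f := by
  induction f using UniqueFactorizationMonoid.induction_on_prime with
  | h₁ => simp
  | h₂ u hu => exact hu.dvd
  | h₃ a p _ hp ih =>
    exact mul_dvd_derivation_mul
      (dvd_derivation_of_prime_of_dvd hp hc₀ hc ((dvd_mul_right p a).trans hfc))
      (ih ((dvd_mul_left a p).trans hfc))

theorem dvd_derivation_iff_of_associated_prod [UniqueFactorizationMonoid A] {f : A} (hf : f ≠ 0)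
    {ι : Type*} {s : Finset ι} {a : ι → A} (h : Associated f (∏ i ∈ s, a i)) :
    f ∣ D f ↔ ∀ i ∈ s, a i ∣ D (a i) :=
  ⟨fun hD _ hi => dvd_derivation_of_dvd hf hD ((Finset.dvd_prod_of_mem a hi).trans h.dvd'),
    fun hD => dvd_derivation_of_dvd (h.ne_zero_iff.1 hf) (prod_dvd_derivation_prod hD) h.dvd⟩

end Derivation

theorem dvd_of_squarefree_of_forall_prime_dvd {M : Type*} [CommMonoidWithZero M] [Nontrivial M]
    [UniqueFactorizationMonoid M] {f c : M} (hf : Squarefree f)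
    (h : ∀ p, Prime p → p ∣ f → p ∣ c) : f ∣ c := by
  induction f using UniqueFactorizationMonoid.induction_on_prime with
  | h₁ => exact absurd hf not_squarefree_zero
  | h₂ u hu => exact hu.dvd
  | h₃ a p _ hp ih =>
    refine IsRelPrime.mul_dvd ?_ (h p hp (dvd_mul_right p a))
      (ih (hf.squarefree_of_dvd (dvd_mul_left a p)) fun q hq hqa =>
        h q hq (hqa.trans (dvd_mul_left a p)))
    rw [hp.irreducible.isRelPrime_iff_not_dvd]
    exact fun hpa => hp.not_isUnit (hf p (mul_dvd_mul_left p hpa))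

section LinearForm

variable {σ R : Type*} [Fintype σ]

section CommSemiring

variable [CommSemiring R]

/-- The linear form `∑ⱼ aⱼ xⱼ` with coefficient vector `a`. -/
noncomputable def linForm : (σ → R) →ₗ[R] MvPolynomial σ R :=
  Fintype.linearCombination R X

theorem linForm_apply (a : σ → R) : linForm a = ∑ j, C (a j) * X j := by
  simp only [linForm, Fintype.linearCombination_apply, smul_eq_C_mul]

theorem eval_linForm (a x : σ → R) : eval x (linForm a) = a ⬝ᵥ x := by
  simp only [linForm_apply, map_sum, map_mul, eval_C, eval_X, dotProduct]

theorem isHomogeneous_linForm (a : σ → R) : (linForm a).IsHomogeneous 1 := by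
  rw [linForm_apply]
  exact IsHomogeneous.sum _ _ _ fun j _ => isHomogeneous_C_mul_X (a j) j

theorem exists_eq_linForm_of_isHomogeneous {p : MvPolynomial σ R} (hp : p.IsHomogeneous 1) :
    ∃ a, p = linForm a := by
  rw [← mem_homogeneousSubmodule, homogeneousSubmodule_one_eq_span_X,
    Submodule.mem_span_range_iff_exists_fun] at hp
  obtain ⟨a, ha⟩ := hp
  exact ⟨a, ha.symm⟩

theorem coeff_linForm (a : σ → R) (k : σ) : coeff (Finsupp.single k 1) (linForm a) = a k := by
  classical
  simp [linForm_apply, coeff_sum, coeff_C_mul, coeff_X, Finsupp.single_left_inj]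

theorem linForm_injective : Function.Injective (linForm (σ := σ) (R := R)) := fun a b h => by
  funext k
  rw [← coeff_linForm a, h, coeff_linForm]

theorem linForm_single [DecidableEq σ] (j : σ) : linForm (Pi.single j (1 : R)) = X j := by
  rw [linForm, Fintype.linearCombination_apply_single, one_smul]

theorem derivation_apply_linForm (δ : Derivation R (MvPolynomial σ R) (MvPolynomial σ R))
    (a : σ → R) : δ (linForm a) = ∑ j, C (a j) * δ (X j) := by
  simp only [linForm, Fintype.linearCombination_apply, map_sum, Derivation.map_smul]
  simp only [smul_eq_C_mul]

end CommSemiring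

variable {K : Type*} [Field K]

theorem linForm_ne_zero {a : σ → K} (ha : a ≠ 0) : linForm a ≠ 0 :=
  (map_ne_zero_iff linForm linForm_injective).2 ha

theorem irreducible_linForm {a : σ → K} (ha : a ≠ 0) : Irreducible (linForm a) := by
  refine irreducible_of_totalDegree_eq_one
    ((isHomogeneous_linForm a).totalDegree (linForm_ne_zero ha)) fun c hc => ?_
  obtain ⟨k, hk⟩ := Function.ne_iff.1 ha
  have hck : c ∣ a k := coeff_linForm a k ▸ hc (Finsupp.single k 1)
  exact isUnit_of_dvd_unit hck (isUnit_iff_ne_zero.2 hk)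

theorem isRelPrime_linForm {ι : Type*} {l : ι → σ → K} (hl : LinearIndependent K l) {i j : ι}
    (hij : i ≠ j) : IsRelPrime (linForm (l i)) (linForm (l j)) := by
  have hi := irreducible_linForm (hl.ne_zero i)
  rw [hi.isRelPrime_iff_not_dvd]
  intro hdvd
  obtain ⟨u, hu⟩ := hi.associated_of_dvd (irreducible_linForm (hl.ne_zero j)) hdvd
  obtain ⟨t, -, ht⟩ := MvPolynomial.isUnit_iff_eq_C_of_isReduced.1 u.isUnit
  rw [ht, mul_comm, ← smul_eq_C_mul, ← map_smul] at hu
  refine hl.notMem_span_image (s := {i}) (x := j) (fun hji => hij hji.symm) ?_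
  rw [Set.image_singleton, ← linForm_injective hu]
  exact Submodule.smul_mem _ _ (Submodule.mem_span_singleton_self _)

end LinearForm

theorem totalDegree_pderiv_le {σ R : Type*} [CommSemiring R] (j : σ) (p : MvPolynomial σ R) :
    (pderiv j p).totalDegree ≤ p.totalDegree - 1 := by
  conv_lhs => rw [← sum_homogeneousComponent p, map_sum]
  refine totalDegree_finsetSum_le fun k hk => ?_
  refine (homogeneousComponent_isHomogeneous k p).pderiv.totalDegree_le.trans ?_
  exact Nat.sub_le_sub_right (Nat.lt_succ_iff.1 (Finset.mem_range.1 hk)) 1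

theorem isUnit_of_totalDegree_eq_zero {σ K : Type*} [Field K] {p : MvPolynomial σ K} (hp₀ : p ≠ 0)
    (hp : p.totalDegree = 0) : IsUnit p := by
  rw [totalDegree_eq_zero_iff_eq_C] at hp
  rw [hp]
  refine (isUnit_iff_ne_zero.2 fun hcoeff => hp₀ ?_).map C
  rw [hp, hcoeff, C_0]

section LinearField

variable {σ R : Type*} [Fintype σ]

theorem derivation_eq_sum_pderiv [CommRing R]
    (δ : Derivation R (MvPolynomial σ R) (MvPolynomial σ R)) (p : MvPolynomial σ R) :
    δ p = ∑ j, δ (X j) * pderiv j p := by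
  classical
  have hδ : δ = ∑ j, δ (X j) • pderiv j := derivation_ext fun i => by
    simp [derivation_sum_apply, pderiv_X, Pi.single_apply]
  conv_lhs => rw [hδ]
  simp only [derivation_sum_apply, Derivation.smul_apply, smul_eq_mul]

/-- The vector field with value `a x` at the point `x`, as a linear function of the matrix `a`. In
particular `linField 1` is the Euler field. -/
noncomputable def linField [CommSemiring R] :
    Matrix σ σ R →ₗ[R] Derivation R (MvPolynomial σ R) (MvPolynomial σ R) where
  toFun a := mkDerivation R fun j => linForm (a j)
  map_add' a b := derivation_ext fun j => by
    rw [Derivation.add_apply, mkDerivation_X, mkDerivation_X, mkDerivation_X, ← map_add]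
    rfl
  map_smul' t a := derivation_ext fun j => by
    rw [RingHom.id_apply, Derivation.smul_apply, mkDerivation_X, mkDerivation_X, ← map_smul]
    rfl

theorem linField_X [CommSemiring R] (a : Matrix σ σ R) (j : σ) :
    linField a (X j) = linForm (a j) :=
  mkDerivation_X _ _ _

section CommRing

variable [CommRing R] [DecidableEq σ] {p : MvPolynomial σ R}

theorem linField_one_of_isHomogeneous {d : ℕ} (hp : p.IsHomogeneous d) :
    linField 1 p = d • p := by
  rw [derivation_eq_sum_pderiv, ← hp.sum_X_mul_pderiv]
  refine Finset.sum_congr rfl fun j _ => ?_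
  have hrow : (1 : Matrix σ σ R) j = Pi.single j 1 := funext fun _ => Matrix.one_eq_pi_single
  rw [linField_X, hrow, linForm_single]

theorem coeff_linField_one (p : MvPolynomial σ R) (m : σ →₀ ℕ) :
    coeff m (linField 1 p) = m.degree * coeff m p := by
  induction p using MvPolynomial.induction_on' with
  | monomial u r =>
    rw [linField_one_of_isHomogeneous (isHomogeneous_monomial r rfl), coeff_smul, coeff_monomial,
      nsmul_eq_mul]
    split_ifs with hum
    · rw [hum]
    · rw [mul_zero, mul_zero]
  | add p q hp hq => rw [map_add, coeff_add, hp, hq, coeff_add, mul_add]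

theorem totalDegree_eq_zero_of_linField_one_eq_zero [NoZeroDivisors R] [CharZero R]
    (hp : linField 1 p = 0) : p.totalDegree = 0 := by
  rw [totalDegree_eq_zero_iff]
  intro m hm x
  have hcoeff := coeff_linField_one p m
  rw [hp, coeff_zero, eq_comm, mul_eq_zero, Nat.cast_eq_zero, Finsupp.degree_eq_zero_iff] at hcoeff
  rw [hcoeff.resolve_right (mem_support_iff.1 hm), Finsupp.zero_apply]

end CommRing

theorem exists_linField_eq_C_mul_of_dvd [CommRing R] [IsDomain R] {a : Matrix σ σ R}
    {f : MvPolynomial σ R} (h : f ∣ linField a f) : ∃ t, linField a f = C t * f := by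
  obtain ⟨q, hq⟩ := h
  rcases eq_or_ne (f * q) 0 with hfq | hfq
  · exact ⟨0, by rw [hq, hfq, C_0, zero_mul]⟩
  have hdeg : (linField a f).totalDegree ≤ f.totalDegree := by
    rcases eq_or_ne f.totalDegree 0 with hf | hf
    · rw [totalDegree_eq_zero_iff_eq_C.1 hf, derivation_C, totalDegree_zero]
      exact Nat.zero_le _
    rw [derivation_eq_sum_pderiv]
    refine totalDegree_finsetSum_le fun j _ => (totalDegree_mul _ _).trans ?_
    have hlin : (linField a (X j)).totalDegree ≤ 1 := by
      rw [linField_X]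
      exact (isHomogeneous_linForm (a j)).totalDegree_le
    have hpderiv := totalDegree_pderiv_le j f
    omega
  rw [hq, totalDegree_mul_of_isDomain (left_ne_zero_of_mul hfq) (right_ne_zero_of_mul hfq),
    add_le_iff_nonpos_right, nonpos_iff_eq_zero, totalDegree_eq_zero_iff_eq_C] at hdeg
  exact ⟨coeff 0 q, by rw [hq, ← hdeg, mul_comm]⟩

end LinearField

theorem exists_not_dvd_pderiv {σ K : Type*} [Finite σ] [Field K] [CharZero K]
    {p : MvPolynomial σ K} (hp : Irreducible p) : ∃ j, ¬ p ∣ pderiv j p := by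
  classical
  let := Fintype.ofFinite σ
  by_contra! h
  have hdeg : p.totalDegree ≠ 0 := fun h₀ =>
    hp.not_isUnit (isUnit_of_totalDegree_eq_zero hp.ne_zero h₀)
  have hpderiv (j : σ) : pderiv j p = 0 := by
    by_contra hj
    have := totalDegree_le_of_dvd_of_isDomain (h j) hj
    have := totalDegree_pderiv_le j p
    omega
  refine hdeg (totalDegree_eq_zero_of_linField_one_eq_zero ?_)
  rw [derivation_eq_sum_pderiv]
  simp only [hpderiv, mul_zero, Finset.sum_const_zero]

section Saito

/-- The Saito matrix of a family of vector fields: its rows are their coefficient vectors. -/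
noncomputable def saitoMatrix {ι σ R : Type*} [CommSemiring R]
    (δ : ι → Derivation R (MvPolynomial σ R) (MvPolynomial σ R)) :
    Matrix ι σ (MvPolynomial σ R) :=
  .of fun i j => δ i (X j)

variable {σ : Type*} [Fintype σ]

theorem saitoMatrix_mulVec_pderiv {ι R : Type*} [CommRing R]
    (δ : ι → Derivation R (MvPolynomial σ R) (MvPolynomial σ R)) (p : MvPolynomial σ R) :
    saitoMatrix δ *ᵥ (fun j => pderiv j p) = fun i => δ i p :=
  funext fun i => (derivation_eq_sum_pderiv (δ i) p).symm

variable [DecidableEq σ]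

theorem dvd_det_saitoMatrix {K : Type*} [Field K] [CharZero K] {f : MvPolynomial σ K}
    {δ : σ → Derivation K (MvPolynomial σ K) (MvPolynomial σ K)} (hf : Squarefree f)
    (hδ : ∀ i, f ∣ δ i f) : f ∣ (saitoMatrix δ).det := by
  have hcramer (j : σ) : f ∣ (saitoMatrix δ).det * pderiv j f := by
    have hadj : (saitoMatrix δ).adjugate *ᵥ (fun i => δ i f) =
        (saitoMatrix δ).det • fun k => pderiv k f := by
      rw [← saitoMatrix_mulVec_pderiv, mulVec_mulVec, adjugate_mul, smul_mulVec, one_mulVec]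
    change f ∣ ((saitoMatrix δ).det • fun k => pderiv k f) j
    rw [← hadj]
    exact Finset.dvd_sum fun i _ => (hδ i).mul_left _
  let : Algebra ℚ K := DivisionRing.toRatAlgebra
  refine dvd_of_squarefree_of_forall_prime_dvd hf fun p hp hpf => ?_
  obtain ⟨j, hj⟩ := exists_not_dvd_pderiv hp.irreducible
  have hpj : p ∣ ((saitoMatrix δ).det • pderiv j) p :=
    dvd_derivation_of_dvd hf.ne_zero (hcramer j) hpf
  exact (hp.dvd_or_dvd hpj).resolve_right hj

theorem det_saitoMatrix_dvd_pow {R : Type*} [CommRing R] {f : MvPolynomial σ R}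
    {δ : σ → Derivation R (MvPolynomial σ R) (MvPolynomial σ R)}
    (hf : ∀ j, f • pderiv j ∈ Submodule.span (MvPolynomial σ R) (Set.range δ)) :
    (saitoMatrix δ).det ∣ f ^ Fintype.card σ := by
  simp only [Submodule.mem_span_range_iff_exists_fun] at hf
  choose c hc using hf
  have hmul : Matrix.of c * saitoMatrix δ = f • 1 := by
    ext1 j k
    have hcX := DFunLike.congr_fun (hc j) (X k)
    simp only [derivation_sum_apply, Derivation.smul_apply, smul_eq_mul] at hcX
    simp only [Matrix.mul_apply, Matrix.of_apply, saitoMatrix, hcX, Matrix.smul_apply, smul_eq_mul,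
      pderiv_X, Matrix.one_apply, Pi.single_apply]
    simp only [eq_comm]
  refine ⟨(Matrix.of c).det, ?_⟩
  rw [mul_comm, ← det_mul, hmul, det_smul, det_one, mul_one]

theorem eval_det_saitoMatrix_linField {R : Type*} [CommRing R] (a : σ → Matrix σ σ R)
    (x : σ → R) :
    eval x (saitoMatrix fun i => linField (a i)).det = (Matrix.of fun i => a i *ᵥ x).det := by
  rw [RingHom.map_det]
  congr 1
  ext i j
  simp only [saitoMatrix, RingHom.mapMatrix_apply, Matrix.map_apply, Matrix.of_apply, linField_X,
    eval_linForm, Matrix.mulVec]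

theorem isHomogeneous_det_saitoMatrix_linField {R : Type*} [CommRing R] (a : σ → Matrix σ σ R) :
    (saitoMatrix fun i => linField (a i)).det.IsHomogeneous (Fintype.card σ) := by
  rw [det_apply]
  refine IsHomogeneous.sum _ _ _ fun τ _ => ?_
  rw [Units.smul_def]
  refine (homogeneousSubmodule σ R _).smul_of_tower_mem _ ?_
  rw [mem_homogeneousSubmodule, Fintype.card_eq_sum_ones]
  refine IsHomogeneous.prod _ _ _ fun i _ => ?_
  rw [saitoMatrix, Matrix.of_apply, linField_X]
  exact isHomogeneous_linForm _

end Saito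

section SaitoBasis

variable {n : ℕ} {f : Coord n} {a : Fin n → Matrix (Fin n) (Fin n) ℂ}

theorem mem_logFields {δ : VectorField n} : δ ∈ logFields f ↔ f ∣ δ f := Iff.rfl

theorem IsLinearField.exists_eq_linField {δ : VectorField n} (hδ : IsLinearField δ) :
    ∃ a, δ = linField a := by
  choose a ha using fun j => exists_eq_linForm_of_isHomogeneous (hδ j)
  exact ⟨a, derivation_ext fun j => (ha j).trans (linField_X a j).symm⟩

theorem IsLinearFree.exists_span_linField_eq (h : IsLinearFree f) :
    ∃ a : Fin n → Matrix (Fin n) (Fin n) ℂ,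
      Submodule.span (Coord n) (Set.range fun i => linField (a i)) = logFields f := by
  obtain ⟨b, hb⟩ := h
  choose a ha using fun i => (hb i).exists_eq_linField
  refine ⟨a, ?_⟩
  rw [← Submodule.map_subtype_top (logFields f), ← b.span_eq, Submodule.map_span,
    ← Set.range_comp]
  exact congrArg (fun δ => Submodule.span (Coord n) (Set.range δ)) (funext fun i => (ha i).symm)

variable (hspan : Submodule.span (Coord n) (Set.range fun i => linField (a i)) = logFields f)
include hspan

theorem linField_mem_logFields (i : Fin n) : linField (a i) ∈ logFields f :=
  hspan ▸ Submodule.subset_span ⟨i, rfl⟩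

theorem det_saitoMatrix_dvd_pow_of_span_eq :
    (saitoMatrix fun i => linField (a i)).det ∣ f ^ n := by
  have h := det_saitoMatrix_dvd_pow (f := f) (δ := fun i => linField (a i)) fun j => by
    rw [hspan]
    exact mem_logFields.2 (dvd_mul_right f _)
  rwa [Fintype.card_fin] at h

theorem eval_eq_zero_iff_det_eq_zero (hf : Squarefree f) (x : Fin n → ℂ) :
    eval x f = 0 ↔ (Matrix.of fun i => a i *ᵥ x).det = 0 := by
  rw [← eval_det_saitoMatrix_linField]
  constructor <;> intro hx
  · have := map_dvd (eval x) (dvd_det_saitoMatrix hf (linField_mem_logFields hspan))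
    rwa [hx, zero_dvd_iff] at this
  · have := map_dvd (eval x) (det_saitoMatrix_dvd_pow_of_span_eq hspan)
    rw [hx, zero_dvd_iff, map_pow] at this
    exact eq_zero_of_pow_eq_zero this

theorem linField_one_mem_logFields (hf : Squarefree f) : linField 1 ∈ logFields f := by
  refine dvd_derivation_of_dvd
    (ne_zero_of_dvd_ne_zero (pow_ne_zero n hf.ne_zero) (det_saitoMatrix_dvd_pow_of_span_eq hspan))
    ?_ (dvd_det_saitoMatrix hf (linField_mem_logFields hspan))
  rw [linField_one_of_isHomogeneous (isHomogeneous_det_saitoMatrix_linField a), nsmul_eq_mul]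
  exact dvd_mul_left _ _

end SaitoBasis

section CommutativeAlgebra

variable {K A : Type*} [Field K] [CommRing A] [Algebra K A] [Module.Finite K A] {x : A}

theorem isUnit_iff_forall_algHom_ne_zero [IsAlgClosed K] :
    IsUnit x ↔ ∀ χ : A →ₐ[K] K, χ x ≠ 0 := by
  refine ⟨fun hx χ => (hx.map χ).ne_zero, fun h => ?_⟩
  by_contra hx
  obtain ⟨I, hI, hxI⟩ := exists_max_ideal_of_mem_nonunits (mem_nonunits_iff.2 hx)
  let : Field (A ⧸ I) := Ideal.Quotient.field I
  let e : K ≃ₐ[K] A ⧸ I := AlgEquiv.ofBijective (Algebra.ofId K (A ⧸ I))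
    (IsAlgClosed.algebraMap_bijective_of_isIntegral (k := K) (K := A ⧸ I))
  refine h ((e.symm : A ⧸ I →ₐ[K] K).comp (Ideal.Quotient.mkₐ K I)) ?_
  rw [AlgHom.comp_apply, Ideal.Quotient.mkₐ_eq_mk, Ideal.Quotient.eq_zero_iff_mem.2 hxI, map_zero]

theorem linearIndependent_basis_mul_iff_isUnit {ι : Type*} (b : Module.Basis ι K A) :
    LinearIndependent K (fun i => b i * x) ↔ IsUnit x := by
  constructor
  · intro h
    have : Finite ι := Module.Finite.finite_basis b
    let := Fintype.ofFinite ι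
    have hspan := h.span_eq_top_of_card_eq_finrank' (Module.finrank_eq_card_basis b).symm
    have hle : Submodule.span K (Set.range fun i => b i * x) ≤ (LinearMap.mulRight K x).range :=
      Submodule.span_le.2 <| by rintro _ ⟨i, rfl⟩; exact ⟨b i, rfl⟩
    obtain ⟨y, hy⟩ := hle (hspan ▸ Submodule.mem_top : (1 : A) ∈ _)
    exact .of_mul_eq_one_right y hy
  · intro hx
    exact b.linearIndependent.map' (LinearMap.mulRight K x)
      (LinearMap.ker_eq_bot.2 (IsUnit.isUnit_iff_mulRight_bijective.1 hx).injective)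

end CommutativeAlgebra

section CommutingEndomorphisms

variable {K V ι : Type*} [Field K] [AddCommGroup V] [Module K V] {a : ι → Module.End K V} {v : V}

theorem isMulCommutative_adjoin_range (hcomm : ∀ i j, Commute (a i) (a j)) :
    IsMulCommutative (Algebra.adjoin K (Set.range a)) :=
  Algebra.isMulCommutative_adjoin K <| by
    rintro _ ⟨i, rfl⟩ _ ⟨j, rfl⟩
    exact hcomm i j

open scoped IsMulCommutative in
theorem exists_linearEquiv_adjoin_of_commute (hcomm : ∀ i j, Commute (a i) (a j))
    (hspan : Submodule.span K (Set.range fun i => a i v) = ⊤) :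
    ∃ e : Algebra.adjoin K (Set.range a) ≃ₗ[K] V, ∀ b, e b = b.1 v := by
  have := isMulCommutative_adjoin_range hcomm
  let gen (i : ι) : Algebra.adjoin K (Set.range a) := ⟨a i, Algebra.subset_adjoin ⟨i, rfl⟩⟩
  let ev : Algebra.adjoin K (Set.range a) →ₗ[K] V :=
    LinearMap.applyₗ v ∘ₗ (Algebra.adjoin K (Set.range a)).val.toLinearMap
  have hinj : Function.Injective ev := by
    rw [← LinearMap.ker_eq_bot, LinearMap.ker_eq_bot']
    refine fun b hb => Subtype.ext (LinearMap.ext_on_range hspan fun i => ?_)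
    have hbi : b.1 * a i = a i * b.1 := congrArg Subtype.val (mul_comm b (gen i))
    change (b.1 * a i) v = 0
    rw [hbi, Module.End.mul_apply]
    exact (congrArg (a i) hb).trans (map_zero _)
  have hsurj : Function.Surjective ev := by
    rw [← LinearMap.range_eq_top, ← top_le_iff, ← hspan, Submodule.span_le]
    rintro _ ⟨i, rfl⟩
    exact ⟨gen i, rfl⟩
  exact ⟨.ofBijective ev ⟨hinj, hsurj⟩, fun _ => rfl⟩

open scoped IsMulCommutative in
theorem exists_linearIndependent_dual_of_commute [IsAlgClosed K] [FiniteDimensional K V]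
    (hcomm : ∀ i j, Commute (a i) (a j)) (b : Module.Basis ι K V) (hb : ∀ i, b i = a i v) :
    ∃ (m : ℕ) (l : Fin m → Module.Dual K V), LinearIndependent K l ∧
      ∀ x, LinearIndependent K (fun i => a i x) ↔ ∀ k, l k x ≠ 0 := by
  have := isMulCommutative_adjoin_range hcomm
  obtain ⟨e, he⟩ := exists_linearEquiv_adjoin_of_commute (v := v) hcomm <| by
    rw [← b.span_eq, funext hb]
  have : Module.Finite K (Algebra.adjoin K (Set.range a)) := .equiv e.symm
  have hmul (i : ι) (x : V) : e.symm (a i x) = b.map e.symm i * e.symm x := by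
    let gen : Algebra.adjoin K (Set.range a) := ⟨a i, Algebra.subset_adjoin ⟨i, rfl⟩⟩
    have hgen : b.map e.symm i = gen := by
      rw [Module.Basis.map_apply, LinearEquiv.symm_apply_eq, hb, he]
    have hx : (e.symm x).1 v = x := by rw [← he, e.apply_symm_apply]
    rw [hgen, LinearEquiv.symm_apply_eq, he]
    exact congrArg (a i) hx.symm
  have hli (x : V) : LinearIndependent K (fun i => a i x) ↔
      ∀ χ : Algebra.adjoin K (Set.range a) →ₐ[K] K, χ (e.symm x) ≠ 0 := by
    rw [← isUnit_iff_forall_algHom_ne_zero,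
      ← linearIndependent_basis_mul_iff_isUnit (b.map e.symm), ← funext fun i => hmul i x]
    exact (LinearMap.linearIndependent_iff e.symm.toLinearMap e.symm.ker).symm
  let r := Finite.equivFin (Algebra.adjoin K (Set.range a) →ₐ[K] K)
  refine ⟨_, fun k => (r.symm k).toLinearMap ∘ₗ e.symm.toLinearMap, ?_, fun x => ?_⟩
  · refine ((linearIndependent_algHom_toLinearMap K (Algebra.adjoin K (Set.range a)) K).comp _
      r.symm.injective).map' e.symm.dualMap.toLinearMap ?_
    exact e.symm.dualMap.ker
  · rw [hli]
    exact r.symm.forall_congr_right.symm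

end CommutingEndomorphisms

section Hyperplanes

variable {σ K : Type*} [Field K] {f : MvPolynomial σ K}

theorem dvd_of_forall_eval_eq_zero [Finite σ] [IsAlgClosed K] {g : MvPolynomial σ K}
    (hf : Squarefree f) (h : ∀ x, eval x f = 0 → eval x g = 0) : f ∣ g := by
  have hg : g ∈ (Ideal.span {f}).radical := by
    rw [← vanishingIdeal_zeroLocus_eq_radical (K := K)]
    intro x hx
    have hfx := hx f (Ideal.mem_span_singleton_self f)
    rw [aeval_eq_eval] at hfx ⊢
    exact h x hfx
  obtain ⟨k, hk⟩ := hg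
  exact hf.isRadical k g (Ideal.mem_span_singleton.1 hk)

theorem eval_prod_linForm_eq_zero_iff {σ ι R : Type*} [Fintype σ] [Fintype ι] [CommRing R]
    [IsDomain R] {l : ι → σ → R} {x : σ → R} :
    eval x (∏ i, linForm (l i)) = 0 ↔ ∃ i, l i ⬝ᵥ x = 0 := by
  simp only [eval_prod, eval_linForm, Finset.prod_eq_zero_iff, Finset.mem_univ, true_and]

theorem associated_prod_linForm [Fintype σ] [IsAlgClosed K] {ι : Type*} [Fintype ι] {l : ι → σ → K}
    (hf : Squarefree f) (hl : LinearIndependent K l)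
    (h : ∀ x, eval x f = 0 ↔ ∃ i, l i ⬝ᵥ x = 0) : Associated f (∏ i, linForm (l i)) := by
  refine associated_of_dvd_dvd ?_ ?_
  · exact dvd_of_forall_eval_eq_zero hf fun x hx => eval_prod_linForm_eq_zero_iff.2 ((h x).1 hx)
  · refine Finset.prod_dvd_of_isRelPrime (fun _ _ _ _ => isRelPrime_linForm hl) fun i _ => ?_
    refine dvd_of_forall_eval_eq_zero (irreducible_linForm (hl.ne_zero i)).squarefree fun x hx => ?_
    exact (h x).2 ⟨i, by rwa [eval_linForm] at hx⟩

end Hyperplanes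

theorem exists_linearIndependent_det_ne_zero_iff {σ K : Type*} [Fintype σ] [DecidableEq σ]
    [Field K] [IsAlgClosed K] {a : σ → Matrix σ σ K} (hcomm : ∀ i j, Commute (a i) (a j))
    {v : σ → K} (hv : (Matrix.of fun i => a i *ᵥ v).det ≠ 0) :
    ∃ (m : ℕ) (l : Fin m → σ → K), LinearIndependent K l ∧
      ∀ x, (Matrix.of fun i => a i *ᵥ x).det ≠ 0 ↔ ∀ k, l k ⬝ᵥ x ≠ 0 := by
  have hdet (x : σ → K) :
      LinearIndependent K (fun i => a i *ᵥ x) ↔ (Matrix.of fun i => a i *ᵥ x).det ≠ 0 := by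
    rw [← isUnit_iff_ne_zero, ← Matrix.isUnit_iff_isUnit_det,
      ← Matrix.linearIndependent_rows_iff_isUnit]
    rfl
  let b : Module.Basis σ K (σ → K) :=
    .mk ((hdet v).2 hv) (((hdet v).2 hv).span_eq_top_of_card_eq_finrank' (by simp)).ge
  obtain ⟨m, l, hl, hlx⟩ := exists_linearIndependent_dual_of_commute
    (a := fun i => Matrix.toLinAlgEquiv' (a i)) (v := v)
    (fun i j => (hcomm i j).map Matrix.toLinAlgEquiv') b (Module.Basis.mk_apply _ _)
  refine ⟨m, fun k => (dotProductEquiv K σ).symm (l k),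
    hl.map' (dotProductEquiv K σ).symm.toLinearMap (dotProductEquiv K σ).symm.ker, fun x => ?_⟩
  rw [← hdet]
  refine (hlx x).trans (forall_congr' fun k => ?_)
  rw [← dotProductEquiv_apply_apply, LinearEquiv.apply_symm_apply]

section ConstantField

variable {σ R : Type*} [CommSemiring R]

/-- The constant vector field with value `v`. -/
noncomputable def constField (v : σ → R) : Derivation R (MvPolynomial σ R) (MvPolynomial σ R) :=
  mkDerivation R fun j => C (v j)

theorem constField_linForm [Fintype σ] (v a : σ → R) : constField v (linForm a) = C (a ⬝ᵥ v) := by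
  simp only [constField, derivation_apply_linForm, mkDerivation_X, dotProduct, map_sum, map_mul]

end ConstantField

section CommutingMatrices

variable {n : ℕ} {f : Coord n} {a : Fin n → Matrix (Fin n) (Fin n) ℂ}

theorem eq_zero_of_constField_mem_logFields
    (hspan : Submodule.span (Coord n) (Set.range fun i => linField (a i)) = logFields f)
    {v : Fin n → ℂ} (hv : constField v ∈ logFields f) : v = 0 := by
  rw [← hspan, Submodule.mem_span_range_iff_exists_fun] at hv
  obtain ⟨c, hc⟩ := hv
  funext j
  -- Linear fields vanish at the origin.
  have hj := congrArg (fun δ : VectorField n => eval 0 (δ (X j))) hc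
  simp only [derivation_sum_apply, Derivation.smul_apply, smul_eq_mul, linField_X, map_sum,
    map_mul, eval_linForm, dotProduct_zero, mul_zero, Finset.sum_const_zero, constField,
    mkDerivation_X, eval_C] at hj
  exact hj.symm

theorem isNormalCrossing_of_associated_prod_linForm (hf : f ≠ 0) {m : ℕ} {l : Fin m → Fin n → ℂ}
    (hl : LinearIndependent ℂ l) (hfl : Associated f (∏ k, linForm (l k)))
    (hconst : ∀ v : Fin n → ℂ, constField v ∈ logFields f → v = 0) : IsNormalCrossing f := by
  have hker : LinearMap.ker (Matrix.of l).mulVecLin = ⊥ := LinearMap.ker_eq_bot'.2 fun v hv => by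
    refine hconst v ((dvd_derivation_iff_of_associated_prod hf hfl).2 fun k _ => ?_)
    have hlv : l k ⬝ᵥ v = 0 := congrFun hv k
    rw [constField_linForm, hlv, C_0]
    exact dvd_zero _
  obtain rfl : m = n := by
    refine le_antisymm ?_ ?_
    · simpa using hl.fintype_card_le_finrank
    · simpa using LinearMap.finrank_le_finrank_of_injective (LinearMap.ker_eq_bot.1 hker)
  have hunit : IsUnit (Matrix.of l) := Matrix.linearIndependent_rows_iff_isUnit.1 hl
  refine ⟨hunit.unit, ?_⟩
  simp only [← linForm_apply]
  exact hfl

theorem isNormalCrossing_of_commute (hf : Squarefree f)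
    (hspan : Submodule.span (Coord n) (Set.range fun i => linField (a i)) = logFields f)
    (hcomm : ∀ i j, Commute (a i) (a j)) : IsNormalCrossing f := by
  have hdet := eval_eq_zero_iff_det_eq_zero hspan hf
  obtain ⟨v, hv⟩ : ∃ v, eval v f ≠ 0 := by
    by_contra! h
    exact hf.ne_zero (MvPolynomial.funext fun x => by rw [h x, map_zero])
  obtain ⟨m, l, hl, hlx⟩ :=
    exists_linearIndependent_det_ne_zero_iff hcomm fun h => hv ((hdet v).2 h)
  refine isNormalCrossing_of_associated_prod_linForm hf.ne_zero hl
    (associated_prod_linForm hf hl fun x => ?_) fun _ => eq_zero_of_constField_mem_logFields hspan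
  rw [hdet, ← not_iff_not, not_exists]
  exact hlx x

end CommutingMatrices

theorem hasDerivAt_eval {σ 𝕜 : Type*} [Fintype σ] [NontriviallyNormedField 𝕜] {γ : 𝕜 → σ → 𝕜}
    {a : Matrix σ σ 𝕜} {t : 𝕜} (hγ : HasDerivAt γ (a *ᵥ γ t) t) (p : MvPolynomial σ 𝕜) :
    HasDerivAt (fun s => eval (γ s) p) (eval (γ t) (linField a p)) t := by
  induction p using MvPolynomial.induction_on with
  | C r =>
    simp only [eval_C, derivation_C, map_zero]
    exact hasDerivAt_const t r
  | add p q hp hq =>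
    simp only [map_add]
    exact hp.add hq
  | mul_X p i hp =>
    simp only [map_mul, eval_X]
    refine (hp.mul (hasDerivAt_pi.1 hγ i)).congr_deriv ?_
    rw [Derivation.leibniz, linField_X]
    simp only [smul_eq_mul, map_add, map_mul, eval_X, eval_linForm, Matrix.mulVec]
    ring

theorem commute_of_forall_commute_exp_smul {𝕜 A : Type*} [RCLike 𝕜] [NormedRing A]
    [NormedAlgebra 𝕜 A] [CompleteSpace A] {a b : A}
    (h : ∀ t : 𝕜, Commute (NormedSpace.exp (t • a)) b) : Commute a b := by
  have hleft := (hasDerivAt_exp_smul_const' a (0 : 𝕜)).mul_const b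
  have hright := (hasDerivAt_exp_smul_const' a (0 : 𝕜)).const_mul b
  rw [funext h] at hleft
  rw [commute_iff_eq]
  simpa only [zero_smul, NormedSpace.exp_zero, mul_one] using hleft.unique hright

section Exponential

attribute [local instance] Matrix.linftyOpNormedRing Matrix.linftyOpNormedAlgebra

section RCLike

variable {σ 𝕜 : Type*} [Fintype σ] [DecidableEq σ] [RCLike 𝕜] {a : Matrix σ σ 𝕜}

/-- The one-parameter group `t ↦ exp(t a)`. -/
noncomputable def expHom (a : Matrix σ σ 𝕜) : Multiplicative 𝕜 →* GL σ 𝕜 :=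
  MonoidHom.toHomUnits
    { toFun := fun t => NormedSpace.exp (t.toAdd • a)
      map_one' := by simp
      map_mul' := fun s t => by
        rw [toAdd_mul, add_smul]
        exact Matrix.exp_add_of_commute _ _ (((Commute.refl a).smul_left _).smul_right _) }

theorem hasDerivAt_exp_smul_mulVec (a : Matrix σ σ 𝕜) (x : σ → 𝕜) (t : 𝕜) :
    HasDerivAt (fun s : 𝕜 => NormedSpace.exp (s • a) *ᵥ x)
      (a *ᵥ (NormedSpace.exp (t • a) *ᵥ x)) t := by
  rw [Matrix.mulVec_mulVec]
  exact (((Matrix.mulVecBilin 𝕜 𝕜).flip x).toContinuousLinearMap).hasFDerivAt.comp_hasDerivAt t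
    (hasDerivAt_exp_smul_const' a t)

theorem eval_expHom_mulVec {f : MvPolynomial σ 𝕜} (ha : linField a f = 0) (t : Multiplicative 𝕜)
    (x : σ → 𝕜) : eval ((expHom a t).val *ᵥ x) f = eval x f := by
  have hderiv (s : 𝕜) : HasDerivAt (fun s : 𝕜 => eval (NormedSpace.exp (s • a) *ᵥ x) f) 0 s := by
    have := hasDerivAt_eval (hasDerivAt_exp_smul_mulVec a x s) f
    rwa [ha, map_zero] at this
  have hconst := is_const_of_deriv_eq_zero (fun s => (hderiv s).differentiableAt)
    (fun s => (hderiv s).deriv) t.toAdd 0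
  rwa [zero_smul, NormedSpace.exp_zero, one_mulVec] at hconst

end RCLike

variable {n : ℕ} {f : Coord n} {a b : Matrix (Fin n) (Fin n) ℂ}

theorem continuous_zariski {X : Type*} [TopologicalSpace X] {γ : X → GL (Fin n) ℂ}
    (hγ : Continuous fun x => (γ x).val) : @Continuous _ _ _ (zariski n) γ := by
  refine continuous_generateFrom_iff.2 ?_
  rintro _ ⟨p, rfl⟩
  have hp : Continuous fun x => eval (fun ij : Fin n × Fin n => γ x ij.1 ij.2) p :=
    (MvPolynomial.continuous_eval p).comp (continuous_pi fun ij => hγ.matrix_elem ij.1 ij.2)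
  exact isOpen_ne.preimage hp

theorem isConnected_range_expHom (a : Matrix (Fin n) (Fin n) ℂ) :
    @IsConnected (GL (Fin n) ℂ) (zariski n) (expHom a).range := by
  let := zariski n
  have hcont : Continuous fun t : ℂ => expHom a (Multiplicative.ofAdd t) :=
    continuous_zariski (differentiable_exp_smul_const ℂ a).continuous
  exact (isConnected_range hcont :)

theorem expHom_mem_groupH (ha : linField a f = 0) (t : Multiplicative ℂ) :
    expHom a t ∈ groupH f := by
  have hle : (expHom a).range ≤ groupH f := by
    refine le_sSup ⟨?_, isConnected_range_expHom a⟩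
    rintro _ ⟨s, rfl⟩
    exact eval_expHom_mulVec ha s
  exact hle ⟨t, rfl⟩

theorem commute_of_linField_eq_zero [IsMulCommutative (groupH f)] (ha : linField a f = 0)
    (hb : linField b f = 0) : Commute a b := by
  refine commute_of_forall_commute_exp_smul (𝕜 := ℂ) fun t => Commute.symm ?_
  refine commute_of_forall_commute_exp_smul (𝕜 := ℂ) fun s => ?_
  exact congrArg Units.val (setLike_mul_comm (expHom_mem_groupH hb (.ofAdd s))
    (expHom_mem_groupH ha (.ofAdd t)))

end Exponential

section CommutativeIsotropy

variable {n : ℕ} {f : Coord n} {a b : Matrix (Fin n) (Fin n) ℂ}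

theorem commute_of_linField_eq_C_mul [IsMulCommutative (groupH f)] {d s t : ℂ} (hd : d ≠ 0)
    (hone : linField 1 f = C d * f) (ha : linField a f = C s * f) (hb : linField b f = C t * f) :
    Commute a b := by
  have hzero {m : Matrix (Fin n) (Fin n) ℂ} {r : ℂ} (hm : linField m f = C r * f) :
      linField (m - (r / d) • 1) f = 0 := by
    rw [map_sub, map_smul, Derivation.sub_apply, Derivation.smul_apply, hm, hone, smul_eq_C_mul,
      ← mul_assoc, ← C_mul, div_mul_cancel₀ _ hd, sub_self]
  have hcomm := commute_of_linField_eq_zero (hzero ha) (hzero hb)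
  have hadd := (hcomm.add_left ((Commute.one_left _).smul_left (s / d))).add_right
    ((Commute.one_right _).smul_right (t / d))
  rwa [sub_add_cancel, sub_add_cancel] at hadd

theorem isNormalCrossing_of_isMulCommutative_groupH (hf : Squarefree f) (hfree : IsLinearFree f)
    [IsMulCommutative (groupH f)] : IsNormalCrossing f := by
  obtain ⟨a, hspan⟩ := hfree.exists_span_linField_eq
  refine isNormalCrossing_of_commute hf hspan fun i j => ?_
  obtain ⟨d, hd⟩ := exists_linField_eq_C_mul_of_dvd (linField_one_mem_logFields hspan hf)
  rcases eq_or_ne d 0 with rfl | hd₀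
  · -- Then `f` is a unit, so that constant fields are logarithmic and `V` is a point.
    rw [C_0, zero_mul] at hd
    have hunit := isUnit_of_totalDegree_eq_zero hf.ne_zero
      (totalDegree_eq_zero_of_linField_one_eq_zero hd)
    have hone : (1 : Fin n → ℂ) = 0 :=
      eq_zero_of_constField_mem_logFields hspan (mem_logFields.2 hunit.dvd)
    exact absurd (congrFun hone i) one_ne_zero
  · obtain ⟨s, hs⟩ := exists_linField_eq_C_mul_of_dvd (linField_mem_logFields hspan i)
    obtain ⟨t, ht⟩ := exists_linField_eq_C_mul_of_dvd (linField_mem_logFields hspan j)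
    exact commute_of_linField_eq_C_mul hd₀ hd hs ht

end CommutativeIsotropy

section CoordinateField

variable {σ R : Type*} [Fintype σ] [DecidableEq σ] [CommRing R]

/-- The vector field `yᵢ ∂/∂yᵢ` in the linear coordinates `y = g x`. -/
noncomputable def coordField (g : GL σ R) (i : σ) :
    Derivation R (MvPolynomial σ R) (MvPolynomial σ R) :=
  linForm (g.val i) • constField fun j => g⁻¹.val j i

theorem coordField_linForm (g : GL σ R) (i k : σ) :
    coordField g i (linForm (g.val k)) = if k = i then linForm (g.val i) else 0 := by
  have hinv : (g.val k ⬝ᵥ fun j => g⁻¹.val j i) = if k = i then 1 else 0 := by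
    rw [← Matrix.one_apply, ← g.mul_inv, Matrix.mul_apply']
  rw [coordField, Derivation.smul_apply, constField_linForm, hinv, smul_eq_mul]
  split_ifs
  · rw [C_1, mul_one]
  · rw [C_0, mul_zero]

theorem isHomogeneous_coordField_X (g : GL σ R) (i j : σ) :
    (coordField g i (X j)).IsHomogeneous 1 := by
  rw [coordField, constField, Derivation.smul_apply, mkDerivation_X, smul_eq_mul, mul_comm]
  exact (isHomogeneous_linForm _).C_mul _

theorem sum_smul_coordField_linForm (g : GL σ R) (c : σ → MvPolynomial σ R) (k : σ) :
    (∑ i, c i • coordField g i) (linForm (g.val k)) = c k * linForm (g.val k) := by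
  simp only [derivation_sum_apply, Derivation.smul_apply, coordField_linForm, smul_eq_mul,
    mul_ite, mul_zero, Finset.sum_ite_eq, Finset.mem_univ, if_true]

theorem derivation_ext_linForm {δ ε : Derivation R (MvPolynomial σ R) (MvPolynomial σ R)}
    (g : GL σ R) (h : ∀ k, δ (linForm (g.val k)) = ε (linForm (g.val k))) : δ = ε := by
  refine derivation_ext fun j => ?_
  have hrow : (Pi.single j 1 : σ → R) = ∑ k, g⁻¹.val j k • g.val k := by
    rw [← Matrix.vecMul_eq_sum, ← Matrix.mul_apply_eq_vecMul, g.inv_mul]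
    exact funext fun _ => Matrix.one_eq_pi_single.symm
  simp only [← linForm_single j, hrow, map_sum, map_smul, Derivation.map_smul, h]

variable {K : Type*} [Field K]

theorem linForm_row_ne_zero (g : GL σ K) (i : σ) : linForm (g.val i) ≠ 0 :=
  linForm_ne_zero ((Matrix.linearIndependent_rows_iff_isUnit.2 g.isUnit).ne_zero i)

theorem linearIndependent_coordField (g : GL σ K) :
    LinearIndependent (MvPolynomial σ K) (coordField g) := by
  refine Fintype.linearIndependent_iff.2 fun c hc k => ?_
  have hck := sum_smul_coordField_linForm g c k
  rw [hc, Derivation.zero_apply, eq_comm, mul_eq_zero] at hck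
  exact hck.resolve_right (linForm_row_ne_zero g k)

end CoordinateField

section NormalCrossing

variable {n : ℕ} {f : Coord n} {g : GL (Fin n) ℂ}

theorem isNormalCrossing_iff_exists_associated :
    IsNormalCrossing f ↔ ∃ g : GL (Fin n) ℂ, Associated f (∏ i, linForm (g.val i)) := by
  simp only [IsNormalCrossing, linForm_apply]

theorem span_range_coordField_eq (hg : Associated f (∏ i, linForm (g.val i))) :
    Submodule.span (Coord n) (Set.range (coordField g)) = logFields f := by
  have hf : f ≠ 0 := hg.ne_zero_iff.2 (Finset.prod_ne_zero_iff.2 fun i _ => linForm_row_ne_zero g i)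
  refine le_antisymm (Submodule.span_le.2 ?_) fun δ hδ => ?_
  · rintro _ ⟨i, rfl⟩
    refine (dvd_derivation_iff_of_associated_prod hf hg).2 fun k _ => ?_
    rw [coordField_linForm]
    split_ifs with hki
    · rw [hki]
    · exact dvd_zero _
  · choose c hc using fun k =>
      (dvd_derivation_iff_of_associated_prod hf hg).1 hδ k (Finset.mem_univ k)
    refine Submodule.mem_span_range_iff_exists_fun _ |>.2 ⟨c, derivation_ext_linForm g fun k => ?_⟩
    rw [sum_smul_coordField_linForm, hc, mul_comm]

theorem IsNormalCrossing.isLinearFree (h : IsNormalCrossing f) : IsLinearFree f := by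
  obtain ⟨g, hg⟩ := isNormalCrossing_iff_exists_associated.1 h
  refine ⟨(Module.Basis.span (linearIndependent_coordField g)).map
    (LinearEquiv.ofEq _ _ (span_range_coordField_eq hg)), fun i => ?_⟩
  rw [Module.Basis.map_apply, LinearEquiv.coe_ofEq_apply, Module.Basis.span_apply]
  exact isHomogeneous_coordField_X g i

theorem mem_hypersurface_iff (hg : Associated f (∏ i, linForm (g.val i))) {x : Fin n → ℂ} :
    x ∈ hypersurface f ↔ ∃ i, (g.val *ᵥ x) i = 0 := by
  have heval : Associated (eval x f) (eval x (∏ i, linForm (g.val i))) := hg.map (eval x)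
  exact heval.eq_zero_iff.trans eval_prod_linForm_eq_zero_iff

end NormalCrossing

section Monomial

theorem isDiag_of_forall_diag_ne_zero {σ R : Type*} [Zero R] {m : Matrix σ σ R}
    (hrow : ∀ i, ∃ j, ∀ k, k ≠ i → m j k = 0) (hdiag : ∀ i, m i i ≠ 0) : m.IsDiag := by
  intro i k hik
  obtain ⟨j, hj⟩ := hrow i
  obtain rfl : j = i := by_contra fun hji => hdiag j (hj j hji)
  exact hj k hik.symm

variable {σ R : Type*} [Fintype σ] [CommRing R] {m : Matrix σ σ R}

theorem exists_row_eq_zero_off [IsDomain R] [Infinite R]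
    (h : ∀ y : σ → R, (∃ i, y i = 0) → ∃ i, (m *ᵥ y) i = 0) (i : σ) :
    ∃ j, ∀ k, k ≠ i → m j k = 0 := by
  classical
  -- Deleting the `i`-th entries of the rows makes their product vanish not only on the hyperplane
  -- `yᵢ = 0` but identically, so one of the shortened rows is zero.
  have hprod : ∏ j, linForm (Function.update (m j) i 0) = 0 := by
    refine MvPolynomial.funext fun y => ?_
    obtain ⟨j, hj⟩ := h (Function.update y i 0) ⟨i, Function.update_self i 0 y⟩
    rw [map_zero, eval_prod_linForm_eq_zero_iff]
    refine ⟨j, Eq.trans (Finset.sum_congr rfl fun k _ => ?_) hj⟩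
    rcases eq_or_ne k i with rfl | hki
    · rw [Function.update_self, Function.update_self, zero_mul, mul_zero]
    · rw [Function.update_of_ne hki, Function.update_of_ne hki]
  obtain ⟨j, -, hj⟩ := Finset.prod_eq_zero_iff.1 hprod
  rw [map_eq_zero_iff linForm linForm_injective] at hj
  refine ⟨j, fun k hki => ?_⟩
  rw [← Function.update_of_ne hki 0 (m j), hj, Pi.zero_apply]

theorem diag_ne_zero_of_isDiag [DecidableEq σ] [Nontrivial R] (hm : m.IsDiag) (hu : IsUnit m)
    (i : σ) : m i i ≠ 0 := by
  intro hi
  have hdet : m.det = 0 := Matrix.det_eq_zero_of_row_eq_zero i fun j => by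
    rcases eq_or_ne i j with rfl | hij
    · exact hi
    · exact hm hij
  exact ((Matrix.isUnit_iff_isUnit_det m).1 hu).ne_zero hdet

theorem commute_of_isDiag {m' : Matrix σ σ R} (hm : m.IsDiag) (hm' : m'.IsDiag) : Commute m m' := by
  classical
  rw [← hm.diagonal_diag, ← hm'.diagonal_diag]
  exact Matrix.commute_diagonal _ _

end Monomial

theorem isMulCommutative_of_le {G : Type*} [Group G] {H K : Subgroup G} (h : H ≤ K)
    [IsMulCommutative K] : IsMulCommutative H :=
  .of_setLike_mul_comm fun _ ha _ hb => setLike_mul_comm (h ha) (h hb)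

section ConnectedGroup

variable {n : ℕ} {f : Coord n} {g h : GL (Fin n) ℂ} {L : Subgroup (GL (Fin n) ℂ)}

theorem isOpen_zariski_conj_apply_ne_zero (g : GL (Fin n) ℂ) (i j : Fin n) :
    @IsOpen _ (zariski n) {h | (g * h * g⁻¹).val i j ≠ 0} := by
  refine TopologicalSpace.isOpen_generateFrom_of_mem
    ⟨∑ k, (∑ l, C (g.val i l) * X (l, k)) * C (g⁻¹.val k j), ?_⟩
  ext h
  simp [Matrix.mul_apply]

theorem isOpen_zariski_diag_conj_ne_zero (g : GL (Fin n) ℂ) :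
    @IsOpen _ (zariski n) {h | ∀ i, (g * h * g⁻¹).val i i ≠ 0} := by
  let := zariski n
  rw [Set.ofPred_forall]
  exact isOpen_iInter_of_finite fun i => isOpen_zariski_conj_apply_ne_zero g i i

theorem isOpen_zariski_not_isDiag_conj (g : GL (Fin n) ℂ) :
    @IsOpen _ (zariski n) {h | ¬ (g * h * g⁻¹).val.IsDiag} := by
  let := zariski n
  simp only [Matrix.IsDiag, Pairwise, not_forall, Set.ofPred_exists]
  exact isOpen_iUnion fun i => isOpen_iUnion fun j => isOpen_iUnion fun _ =>
    isOpen_zariski_conj_apply_ne_zero g i j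

theorem exists_row_conj_eq_zero_off (hg : Associated f (∏ i, linForm (g.val i)))
    (hh : h ∈ preserver (hypersurface f)) (i : Fin n) :
    ∃ j, ∀ k, k ≠ i → (g * h * g⁻¹).val j k = 0 := by
  refine exists_row_eq_zero_off (fun y hy => ?_) i
  have hx : g⁻¹.val *ᵥ y ∈ hypersurface f := by
    rwa [mem_hypersurface_iff hg, mulVec_mulVec, g.mul_inv, one_mulVec]
  have hhx : h.val *ᵥ (g⁻¹.val *ᵥ y) ∈ hypersurface f :=
    (hh : _ '' hypersurface f = hypersurface f) ▸ Set.mem_image_of_mem _ hx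
  rwa [mem_hypersurface_iff hg, mulVec_mulVec, mulVec_mulVec, ← Units.val_mul,
    ← Units.val_mul] at hhx

theorem isDiag_conj_of_isPreconnected (hL : @IsPreconnected _ (zariski n) L)
    (hrow : ∀ h ∈ L, ∀ i, ∃ j, ∀ k, k ≠ i → (g * h * g⁻¹).val j k = 0) (hh : h ∈ L) :
    (g * h * g⁻¹).val.IsDiag := by
  by_contra hdiag
  obtain ⟨k, hk, hk_diag, hk_not⟩ := hL _ _ (isOpen_zariski_diag_conj_ne_zero g)
    (isOpen_zariski_not_isDiag_conj g)
    (fun k _ => or_iff_not_imp_right.2 fun hk =>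
      diag_ne_zero_of_isDiag (not_not.1 hk) (g * k * g⁻¹).isUnit)
    ⟨1, L.one_mem, by simp⟩ ⟨h, hh, hdiag⟩
  exact hk_not (isDiag_of_forall_diag_ne_zero (hrow k hk) hk_diag)

theorem IsNormalCrossing.isMulCommutative_groupG (h : IsNormalCrossing f) :
    IsMulCommutative (groupG f) := by
  obtain ⟨g, hg⟩ := isNormalCrossing_iff_exists_associated.1 h
  have hle : groupG f ≤ Subgroup.closure {h | (g * h * g⁻¹).val.IsDiag} :=
    sSup_le fun L hL h hh => Subgroup.subset_closure <|
      isDiag_conj_of_isPreconnected hL.2.2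
        (fun _ hk => exists_row_conj_eq_zero_off hg (hL.1 hk)) hh
  have : IsMulCommutative (Subgroup.closure {h | (g * h * g⁻¹).val.IsDiag}) :=
    Subgroup.isMulCommutative_closure fun a ha b hb =>
      (Commute.conj_iff g).1 (Units.ext (commute_of_isDiag ha hb))
  exact isMulCommutative_of_le hle

theorem isotropy_le_preserver (f : Coord n) : isotropy f ≤ preserver (hypersurface f) := by
  intro g hg
  refine Set.Subset.antisymm ?_ fun x hx => ?_
  · rintro _ ⟨y, hy, rfl⟩
    exact (hg y).trans hy
  · refine ⟨g⁻¹.val *ᵥ x, ((isotropy f).inv_mem hg x).trans hx, ?_⟩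
    simp only [mulVec_mulVec, g.mul_inv, one_mulVec]

theorem groupH_le_groupG (f : Coord n) : groupH f ≤ groupG f :=
  sSup_le_sSup fun _ hL => ⟨hL.1.trans (isotropy_le_preserver f), hL.2⟩

end ConnectedGroup

end LinearFreeDivisor

open LinearFreeDivisor

theorem mainTheorem11 {n : ℕ} (f : LinearFreeDivisor.Coord n) (hf : Squarefree f) :
    ((LinearFreeDivisor.IsLinearFree f ∧ IsMulCommutative (LinearFreeDivisor.groupG f)) ↔
      LinearFreeDivisor.IsNormalCrossing f) ∧
    ((LinearFreeDivisor.IsLinearFree f ∧ IsMulCommutative (LinearFreeDivisor.groupH f)) ↔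
      LinearFreeDivisor.IsNormalCrossing f) := by
  have hcomm : IsMulCommutative (groupG f) → IsMulCommutative (groupH f) := fun _ =>
    isMulCommutative_of_le (groupH_le_groupG f)
  have hcrossing : IsLinearFree f ∧ IsMulCommutative (groupH f) → IsNormalCrossing f :=
    fun ⟨hfree, _⟩ => isNormalCrossing_of_isMulCommutative_groupH hf hfree
  exact
    ⟨⟨fun h => hcrossing ⟨h.1, hcomm h.2⟩, fun h => ⟨h.isLinearFree, h.isMulCommutative_groupG⟩⟩,
      ⟨hcrossing, fun h => ⟨h.isLinearFree, hcomm h.isMulCommutative_groupG⟩⟩⟩
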